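/- Let $K$ be a field and let $q\in K$ (for example $K=\mathbb{R}$ and $q\in[0,1]$). Let $X$ and $\Delta$ generate the $K$-algebra $K\langle X,\Delta\rangle/(\Delta X-qX\Delta-1)$; these relations are satisfied by the operator $X$ of multiplication by $x$ and the $q$-difference operator $\Delta f(x)=\frac{f(qx)-f(x)}{(q-1)x}$ (when $q\neq1$). Every element $\mathfrak h$ of this algebra has a unique normal form $\mathfrak h=\sum_{a,b\ge 0}c_{a,b}X^a\Delta^b$ (a finite sum), and its constant term is $c_{0,0}$. For $n\ge 0$ let $I_n(q)$ be the constant term of the normal form of $(X+\Delta)^n$, and let $[k]_q=1+q+\cdots+q^{k-1}$. Then, as formal power series in $z$, \[ \sum_{n\ge0} I_n(q)z^n= \cfrac{1}{1-\cfrac{[1]_q\, z^2}{1-\cfrac{[2]_q\, z^2}{1-\cfrac{[3]_q\, z^2}{\ddots}}}}, \] where the infinite continued fraction is the coefficientwise limit of its finite truncations. Furthermore, for every $n\ge0$ one has $I_{2n+1}(q)=0$ and, if $q\ne1$, \[ I_{2n}(q)=\frac{1}{(1-q)^n}\sum_{k=-n}^{n}(-1)^k q^{k(k-1)/2}\binom{2n}{n+k}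 \] (the Touchard--Riordan formula). -/

import Mathlib

/-- The `q`-integer `[n]_q = 1 + q + ⋯ + q^(n-1)`. -/
def qInt {K : Type*} [Semiring K] (q : K) (n : ℕ) : K := ∑ i ∈ Finset.range n, q ^ i

/-- The two letters `X` and `Δ`. -/
inductive QLetter : Type
  | X : QLetter
  | Δ : QLetter

/-- The relation `Δ X = 1 + q X Δ` on noncommutative polynomials in `X` and `Δ`. -/
inductive QWeylRel (K : Type*) [Field K] (q : K) :
    FreeAlgebra K QLetter → FreeAlgebra K QLetter → Prop
  | comm : QWeylRel K q
      (FreeAlgebra.ι K QLetter.Δ * FreeAlgebra.ι K QLetter.X)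
      (1 + q • (FreeAlgebra.ι K QLetter.X * FreeAlgebra.ι K QLetter.Δ))

/-- Operator polynomials in `X` and `Δ`: the quotient of the free algebra `K⟨X, Δ⟩` by the
two-sided ideal generated by `Δ X - q X Δ - 1`. -/
abbrev QWeyl (K : Type*) [Field K] (q : K) : Type _ := RingQuot (QWeylRel K q)

namespace QWeyl

variable {K : Type*} [Field K] (q : K)

/-- The image of a letter in the quotient algebra. -/
def letter (l : QLetter) : QWeyl K q :=
  RingQuot.mkAlgHom K (QWeylRel K q) (FreeAlgebra.ι K l)

/-- The element `X`. -/
def opX : QWeyl K q := letter q QLetter.X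

/-- The element `Δ`. -/
def opΔ : QWeyl K q := letter q QLetter.Δ

/-- The normally ordered monomial `X^a Δ^b`. -/
def monom (p : ℕ × ℕ) : QWeyl K q := opX q ^ p.1 * opΔ q ^ p.2

theorem opΔ_mul_opX : opΔ q * opX q = 1 + q • (opX q * opΔ q) := by
  have h := RingQuot.mkAlgHom_rel K (QWeylRel.comm (K := K) (q := q))
  rw [map_mul, map_add, map_one, map_smul, map_mul] at h
  exact h

theorem qInt_succ (a : ℕ) : qInt q (a + 1) = 1 + q * qInt q a := by
  unfold qInt
  rw [Finset.sum_range_succ', Finset.mul_sum, add_comm]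
  simp [pow_succ']

theorem opΔ_mul_pow (a : ℕ) :
    opΔ q * opX q ^ (a + 1) =
      q ^ (a + 1) • (opX q ^ (a + 1) * opΔ q) + qInt q (a + 1) • opX q ^ a := by
  induction a with
  | zero => simp [opΔ_mul_opX, qInt, add_comm]
  | succ a ih =>
    rw [pow_succ' (opX q) (a + 1), ← mul_assoc, opΔ_mul_opX, add_mul, one_mul, smul_mul_assoc,
      mul_assoc, ih, qInt_succ q (a + 1), mul_add, smul_add, mul_smul_comm, mul_smul_comm,
      smul_smul, smul_smul, ← pow_succ', ← pow_succ', ← mul_assoc, ← pow_succ', add_smul, one_smul]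
    abel

/-- Left multiplication by `X` on normally ordered monomials. -/
noncomputable def actX : (ℕ × ℕ →₀ K) →ₗ[K] (ℕ × ℕ →₀ K) :=
  Finsupp.linearCombination K fun p => Finsupp.single (p.1 + 1, p.2) 1

/-- Left multiplication by `Δ` on normally ordered monomials. -/
noncomputable def actΔ : (ℕ × ℕ →₀ K) →ₗ[K] (ℕ × ℕ →₀ K) :=
  Finsupp.linearCombination K fun p =>
    Finsupp.single (p.1, p.2 + 1) (q ^ p.1) + Finsupp.single (p.1 - 1, p.2) (qInt q p.1)

theorem actX_single (a b : ℕ) (c : K) :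
    actX (Finsupp.single (a, b) c) = Finsupp.single (a + 1, b) c := by
  simp [actX]

theorem actΔ_single (a b : ℕ) (c : K) :
    actΔ q (Finsupp.single (a, b) c) =
      Finsupp.single (a, b + 1) (c * q ^ a) + Finsupp.single (a - 1, b) (c * qInt q a) := by
  simp [actΔ]

theorem actΔ_mul_actX : actΔ q * actX = 1 + q • (actX * actΔ q) := by
  refine Finsupp.lhom_ext' fun p => LinearMap.ext_ring ?_
  obtain ⟨a, b⟩ := p
  change actΔ q (actX (Finsupp.single (a, b) 1)) =
    Finsupp.single (a, b) 1 + q • actX (actΔ q (Finsupp.single (a, b) 1))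
  rw [actX_single, actΔ_single, actΔ_single, map_add, actX_single, actX_single, qInt_succ]
  rcases a with _ | a
  · simp [qInt, add_comm]
  · simp [pow_succ' q (a + 1), Finsupp.single_add]
    abel

/-- The left regular representation, written on normally ordered monomials. -/
noncomputable def act : QWeyl K q →ₐ[K] Module.End K (ℕ × ℕ →₀ K) :=
  RingQuot.liftAlgHom K ⟨FreeAlgebra.lift K (fun l => match l with
    | QLetter.X => actX
    | QLetter.Δ => actΔ q), by
      rintro _ _ ⟨⟩
      simpa using actΔ_mul_actX q⟩

theorem act_opX : act q (opX q) = actX := by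
  simp [act, opX, letter]

theorem act_opΔ : act q (opΔ q) = actΔ q := by
  simp [act, opΔ, letter]

theorem act_monom (p : ℕ × ℕ) :
    act q (monom q p) (Finsupp.single (0, 0) 1) = Finsupp.single p 1 := by
  obtain ⟨a, b⟩ := p
  have h1 : (actΔ q ^ b) (Finsupp.single (0, 0) (1 : K)) = Finsupp.single (0, b) 1 := by
    induction b with
    | zero => simp
    | succ b ih => rw [pow_succ', Module.End.mul_apply, ih, actΔ_single]; simp [qInt]
  have h2 : ((actX : Module.End K (ℕ × ℕ →₀ K)) ^ a) (Finsupp.single (0, b) (1 : K))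
      = Finsupp.single (a, b) 1 := by
    induction a with
    | zero => simp
    | succ a ih => rw [pow_succ', Module.End.mul_apply, ih, actX_single]
  simp [monom, act_opX, act_opΔ, h1, h2]

theorem linearIndependent_monom : LinearIndependent K (monom q) := by
  have h : LinearIndependent K fun p : ℕ × ℕ => (Finsupp.single p 1 : ℕ × ℕ →₀ K) :=
    Finsupp.linearIndependent_single_one K (ℕ × ℕ)
  refine LinearIndependent.of_comp
    ((LinearMap.applyₗ (Finsupp.single (0, 0) (1 : K))).comp (act q).toLinearMap) ?_
  convert h using 1
  funext p
  simpa using act_monom q p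

theorem span_monom : ⊤ ≤ Submodule.span K (Set.range (monom q)) := by
  set S := Submodule.span K (Set.range (monom q)) with hS
  have mem : ∀ p, monom q p ∈ S := fun p => Submodule.subset_span ⟨p, rfl⟩
  have key : ∀ l, ∀ x ∈ S, letter q l * x ∈ S := by
    intro l x hx
    induction hx using Submodule.span_induction with
    | zero => simp
    | add x y _ _ hx hy => rw [mul_add]; exact S.add_mem hx hy
    | smul c x _ hx => rw [mul_smul_comm]; exact S.smul_mem c hx
    | mem x hx =>
      obtain ⟨⟨a, b⟩, rfl⟩ := hx
      cases l with
      | X =>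
        have h := mem (a + 1, b)
        simpa [monom, pow_succ', mul_assoc, opX] using h
      | Δ =>
        change opΔ q * _ ∈ S
        rcases a with _ | a
        · have h := mem (0, b + 1)
          simpa [monom, pow_succ'] using h
        · have e : opΔ q * monom q (a + 1, b) =
              q ^ (a + 1) • monom q (a + 1, b + 1) + qInt q (a + 1) • monom q (a, b) := by
            simp only [monom]
            rw [← mul_assoc, opΔ_mul_pow, add_mul, smul_mul_assoc, smul_mul_assoc, mul_assoc,
              ← pow_succ']
          rw [e]
          exact S.add_mem (S.smul_mem _ (mem _)) (S.smul_mem _ (mem _))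
  have all : ∀ f : FreeAlgebra K QLetter, ∀ x ∈ S,
      RingQuot.mkAlgHom K (QWeylRel K q) f * x ∈ S := by
    intro f
    induction f using FreeAlgebra.induction with
    | grade0 r =>
      intro x hx
      rw [AlgHom.commutes, ← Algebra.smul_def]
      exact S.smul_mem r hx
    | grade1 l => exact key l
    | mul f g hf hg =>
      intro x hx
      rw [map_mul, mul_assoc]
      exact hf _ (hg _ hx)
    | add f g hf hg =>
      intro x hx
      rw [map_add, add_mul]
      exact S.add_mem (hf _ hx) (hg _ hx)
  intro x _
  obtain ⟨f, rfl⟩ := RingQuot.mkAlgHom_surjective K (QWeylRel K q) x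
  have h := all f 1 (by simpa [monom] using mem (0, 0))
  simpa using h

/-- The normally ordered monomials `X^a Δ^b` form a basis. -/
noncomputable def monomBasis : Module.Basis (ℕ × ℕ) K (QWeyl K q) :=
  Module.Basis.mk (linearIndependent_monom q) (span_monom q)

/-- The normal form of `h`: the unique family of coefficients `c` (finitely supported) with
`h = ∑ c (a, b) X^a Δ^b`. -/
noncomputable def normalForm (h : QWeyl K q) : ℕ × ℕ →₀ K := (monomBasis q).repr h

/-- The constant term of the normal form: the coefficient of `X^0 Δ^0`. -/
noncomputable def constantTerm (h : QWeyl K q) : K := normalForm q h (0, 0)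

/-- `I_n(q)`, the constant term of the normal form of `(X + Δ)^n`. -/
noncomputable def constI (n : ℕ) : K := constantTerm q ((opX q + opΔ q) ^ n)

/-- The `q`-difference operator on polynomials, `x^n ↦ [n]_q x^(n-1)`. -/
noncomputable def qDiff : Module.End K (Polynomial K) :=
  (Polynomial.basisMonomials K).constr K fun n => Polynomial.monomial (n - 1) (qInt q n)

theorem qDiff_monomial (n : ℕ) (c : K) :
    qDiff q (Polynomial.monomial n c) = Polynomial.monomial (n - 1) (c * qInt q n) := by
  have h := (Polynomial.basisMonomials K).constr_basis K
    (fun n => Polynomial.monomial (n - 1) (qInt q n)) n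
  rw [Polynomial.coe_basisMonomials] at h
  have e : Polynomial.monomial n c = c • Polynomial.monomial n (1 : K) := by
    rw [Polynomial.smul_monomial, smul_eq_mul, mul_one]
  rw [e, map_smul, qDiff, h, Polynomial.smul_monomial, smul_eq_mul]

/-- `Δ f (x) = (f (q x) - f x) / ((q - 1) x)`, with the denominator cleared. -/
theorem qDiff_spec (f : Polynomial K) :
    Polynomial.C (q - 1) * Polynomial.X * qDiff q f =
      f.comp (Polynomial.C q * Polynomial.X) - f := by
  induction f using Polynomial.induction_on' with
  | add f g hf hg => rw [map_add, mul_add, hf, hg, Polynomial.add_comp]; ring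
  | monomial n c =>
    have h : (q - 1) * qInt q n = q ^ n - 1 := mul_geom_sum q n
    rw [qDiff_monomial, Polynomial.monomial_comp, mul_pow, mul_assoc, Polynomial.X_mul_monomial,
      Polynomial.C_mul_monomial]
    rcases n with _ | n
    · simp [qInt]
    · rw [show (q - 1) * (c * qInt q (n + 1)) = c * (q ^ (n + 1) - 1) by rw [← h]; ring]
      simp only [← Polynomial.C_mul_X_pow_eq_monomial, map_mul, map_sub, map_pow, map_one]
      rw [Nat.add_sub_cancel]
      ring

theorem qDiff_mul_X : qDiff q * LinearMap.mulLeft K Polynomial.X =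
    1 + q • (LinearMap.mulLeft K Polynomial.X * qDiff q) := by
  refine Polynomial.lhom_ext' fun n => LinearMap.ext_ring ?_
  simp only [LinearMap.comp_apply, Module.End.mul_apply, LinearMap.add_apply,
    LinearMap.smul_apply, Module.End.one_apply, LinearMap.mulLeft_apply]
  rw [Polynomial.X_mul_monomial, qDiff_monomial, qDiff_monomial, Polynomial.X_mul_monomial,
    qInt_succ, Polynomial.smul_monomial]
  rcases n with _ | n
  · simp [qInt]
  · rw [Nat.add_sub_cancel, Nat.add_sub_cancel, ← map_add]
    simp

/-- Substitution of the multiplication operator and the `q`-difference operator for the letters. -/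
noncomputable def substOperators : FreeAlgebra K QLetter →ₐ[K] Module.End K (Polynomial K) :=
  FreeAlgebra.lift K (fun l => match l with
    | QLetter.X => LinearMap.mulLeft K Polynomial.X
    | QLetter.Δ => qDiff q)

theorem substOperators_rel ⦃f g : FreeAlgebra K QLetter⦄ (h : QWeylRel K q f g) :
    substOperators q f = substOperators q g := by
  have hX : substOperators q (FreeAlgebra.ι K QLetter.X) = LinearMap.mulLeft K Polynomial.X :=
    FreeAlgebra.lift_ι_apply _ _
  have hΔ : substOperators q (FreeAlgebra.ι K QLetter.Δ) = qDiff q :=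
    FreeAlgebra.lift_ι_apply _ _
  obtain ⟨⟩ := h
  rw [map_mul, map_add, map_one, map_smul, map_mul, hX, hΔ]
  exact qDiff_mul_X q

/-- The realization of the algebra by operators on polynomials: `X` is multiplication by the
variable and `Δ` is the `q`-difference operator. -/
noncomputable def toOperators : QWeyl K q →ₐ[K] Module.End K (Polynomial K) :=
  RingQuot.liftAlgHom (A := FreeAlgebra K QLetter) K
    (⟨substOperators q, substOperators_rel q⟩ :
      { f : FreeAlgebra K QLetter →ₐ[K] Module.End K (Polynomial K) //
        ∀ ⦃x y⦄, QWeylRel K q x y → f x = f y })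

end QWeyl

/-- The finite continued fraction `1/(1 - a₀/(1 - a₁/(⋯/(1 - a_{m-1}))))` of formal power series.
It is used for `a i` without constant term, so every denominator has constant term `1`. -/
noncomputable def cfConvergent {K : Type*} [Field K] :
    ℕ → (ℕ → PowerSeries K) → PowerSeries K
  | 0, _ => 1
  | m + 1, a => (1 - a 0 * cfConvergent m (fun i => a (i + 1)))⁻¹

/-- `F = 1/(1 - a₀/(1 - a₁/(1 - ⋯)))` as formal power series: each coefficient of the finite
continued fractions is eventually equal to that of `F`. -/
def EqContinuedFraction {K : Type*} [Field K] (F : PowerSeries K) (a : ℕ → PowerSeries K) :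
    Prop :=
  ∀ n : ℕ, ∀ᶠ m in Filter.atTop,
    PowerSeries.coeff n (cfConvergent m a) = PowerSeries.coeff n F

/-!
Let `T = X + Δ` act on `K[x]` through `X ↦` multiplication by `x` and `Δ ↦` the `q`-difference
operator. Since `Δ` kills constants, the constant term of a normal form `∑ c (a, b) X^a Δ^b` is the
constant coefficient of its value at the polynomial `1` (`constantTerm_eq_coeff`). Hence
`I_n(q) = t n 0`, where `t n h` (`towerCoeff`) is the coefficient of `x^h` in `T^n 1`. These numbers
count weighted paths with steps `±1` from level `0` to level `h`, and satisfy
`t (n+1) h = t n (h-1) + [h+1]_q t n (h+1)`; in particular they vanish when `n + h` is odd.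

*Continued fraction.* The series `S_h = ∑ t (h+n) h z^n` have constant term `1`, and the recurrence
reads `S_0 = 1 + [1]_q z² S_1`, `S_{h+1} = S_h + [h+2]_q z² S_{h+2}`. The quotients
`R_0 = S_0`, `R_{h+1} = S_{h+1} / S_h` therefore satisfy `R_h = 1 / (1 - [h+1]_q z² R_{h+1})`, and
any such tail sequence is the limit of the convergents, as each level gains a factor `z`
(`eqContinuedFraction_of_tails`).

*Touchard–Riordan.* More generally, at every level `h`,
`(1-q)^m t (h+2m) h = ∑_j (binom (h+2m) (m-j) - binom (h+2m) (m-j-1)) c_j^h` with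
`c_j^h = (-1)^j q^(j(j+1)/2) binom(h+j, j)_q` (`one_sub_pow_mul_towerCoeff`). Both sides satisfy the
same recurrence, because ballot numbers satisfy Pascal's rule and
`c_{j+1}^{h+1} + c_j^{h+1} = c_{j+1}^h + (1-q^(h+2)) c_j^{h+2}`, a form of the `q`-Pascal rule. At
`h = 0` the two binomial coefficients are the terms `-j` and `j+1` of the two-sided sum.
-/

open Finset

/-! ### Constant terms and the action on polynomials -/

namespace QWeyl

variable {K : Type*} [Field K] (q : K)

theorem toOperators_opX : toOperators q (opX q) = LinearMap.mulLeft K Polynomial.X := by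
  simp [toOperators, opX, letter, substOperators]

theorem toOperators_opΔ : toOperators q (opΔ q) = qDiff q := by
  simp [toOperators, opΔ, letter, substOperators]

theorem coeff_qDiff (f : Polynomial K) (h : ℕ) :
    (qDiff q f).coeff h = qInt q (h + 1) * f.coeff (h + 1) := by
  induction f using Polynomial.induction_on' with
  | add f g hf hg => simp only [map_add, Polynomial.coeff_add, hf, hg, mul_add]
  | monomial n c =>
    rw [qDiff_monomial, Polynomial.coeff_monomial, Polynomial.coeff_monomial]
    rcases n with _ | n
    · simp [qInt]
    · simp only [Nat.add_sub_cancel, Nat.add_right_cancel_iff]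
      split_ifs with e
      · rw [e, mul_comm]
      · rw [mul_zero]

theorem constantTerm_eq_coeff (f : QWeyl K q) :
    constantTerm q f = (toOperators q f 1).coeff 0 := by
  have key : (Finsupp.lapply (0, 0)).comp (monomBasis q).repr.toLinearMap =
      ((Polynomial.lcoeff K 0).comp (LinearMap.applyₗ (1 : Polynomial K))).comp
        (toOperators q).toLinearMap := by
    refine (monomBasis q).ext ?_
    rintro ⟨a, b⟩
    have hb : monomBasis q (a, b) = opX q ^ a * opΔ q ^ b := by simp [monomBasis, monom]
    have hΔ : qDiff q (1 : Polynomial K) = 0 := by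
      rw [← Polynomial.monomial_zero_one, qDiff_monomial]
      simp [qInt]
    have hX : (LinearMap.mulLeft K (Polynomial.X : Polynomial K)) ^ a =
        LinearMap.mulLeft K (Polynomial.X ^ a) := LinearMap.pow_mulLeft _ _ _ _
    change ((monomBasis q).repr (monomBasis q (a, b))) (0, 0) =
      (toOperators q (monomBasis q (a, b)) 1).coeff 0
    rw [Module.Basis.repr_self, hb, map_mul, map_pow, map_pow, toOperators_opX, toOperators_opΔ,
      hX, Module.End.mul_apply, LinearMap.mulLeft_apply]
    rcases b with _ | b
    · cases a <;> simp
    · rw [pow_succ (qDiff q), Module.End.mul_apply, hΔ]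
      simp
  exact LinearMap.congr_fun key f

/-- The coefficient of `x^h` in `(X + Δ)^n` applied to the polynomial `1`. -/
noncomputable def towerCoeff (n h : ℕ) : K :=
  (toOperators q ((opX q + opΔ q) ^ n) 1).coeff h

theorem constI_eq_towerCoeff (n : ℕ) : constI q n = towerCoeff q n 0 :=
  constantTerm_eq_coeff q _

theorem towerCoeff_zero (h : ℕ) : towerCoeff q 0 h = if h = 0 then 1 else 0 := by
  simp [towerCoeff, Polynomial.coeff_one]

theorem towerCoeff_succ_zero (n : ℕ) : towerCoeff q (n + 1) 0 = qInt q 1 * towerCoeff q n 1 := by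
  simp [towerCoeff, pow_succ', toOperators_opX, toOperators_opΔ, coeff_qDiff]

theorem towerCoeff_succ_succ (n h : ℕ) : towerCoeff q (n + 1) (h + 1) =
    towerCoeff q n h + qInt q (h + 2) * towerCoeff q n (h + 2) := by
  simp [towerCoeff, pow_succ', toOperators_opX, toOperators_opΔ, coeff_qDiff]

theorem towerCoeff_eq_zero_of_lt {n h : ℕ} (hn : n < h) : towerCoeff q n h = 0 := by
  induction n generalizing h with
  | zero => rw [towerCoeff_zero, if_neg (by omega)]
  | succ n ih =>
    obtain ⟨h, rfl⟩ : ∃ k, h = k + 1 := ⟨h - 1, by omega⟩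
    rw [towerCoeff_succ_succ, ih (by omega), ih (by omega), mul_zero, add_zero]

theorem towerCoeff_eq_zero_of_odd {n h : ℕ} (hn : Odd (n + h)) : towerCoeff q n h = 0 := by
  induction n generalizing h with
  | zero => rw [towerCoeff_zero, if_neg (by rintro rfl; simp at hn)]
  | succ n ih =>
    rcases h with _ | h
    · rw [towerCoeff_succ_zero, ih (by simpa using hn), mul_zero]
    · have hn' : Odd (n + h) := by grind
      rw [towerCoeff_succ_succ, ih hn', ih (by grind), mul_zero, add_zero]

theorem towerCoeff_self (h : ℕ) : towerCoeff q h h = 1 := by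
  induction h with
  | zero => simp [towerCoeff_zero]
  | succ h ih =>
    rw [towerCoeff_succ_succ, ih, towerCoeff_eq_zero_of_lt q (by omega), mul_zero, add_zero]

end QWeyl

/-! ### Convergence of continued fractions -/

/-- A sequence of tails `R k = 1 / (1 - a k * R (k+1))` determines the continued fraction: the
`m`-th convergent agrees with `R 0` modulo `X^(m+1)`. -/
theorem eqContinuedFraction_of_tails {K : Type*} [Field K] (a R : ℕ → PowerSeries K)
    (ha : ∀ k, PowerSeries.X ∣ a k) (hR : ∀ k, (1 - a k * R (k + 1)) * R k = 1) :
    EqContinuedFraction (R 0) a := by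
  have key : ∀ m k, (PowerSeries.X : PowerSeries K) ^ (m + 1) ∣
      cfConvergent m (fun i => a (i + k)) - R k := by
    intro m
    induction m with
    | zero =>
      intro k
      have e : cfConvergent 0 (fun i => a (i + k)) - R k = a k * (-(R (k + 1) * R k)) := by
        simp only [cfConvergent]
        linear_combination -hR k
      rw [e, zero_add, pow_one]
      exact (ha k).mul_right _
    | succ m ih =>
      intro k
      set C := cfConvergent m (fun i => a (i + (k + 1)))
      have hC : cfConvergent (m + 1) (fun i => a (i + k)) = (1 - a k * C)⁻¹ := by
        simp only [cfConvergent, zero_add, C, add_assoc, add_comm 1 k]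
      have hinv : (1 - a k * C)⁻¹ * (1 - a k * C) = 1 := by
        refine PowerSeries.inv_mul_cancel _ ?_
        have h0 : PowerSeries.constantCoeff (a k) = 0 := PowerSeries.X_dvd_iff.mp (ha k)
        simp [h0]
      have e : (1 - a k * C)⁻¹ - R k =
          a k * (C - R (k + 1)) * ((1 - a k * C)⁻¹ * R k) := by
        linear_combination (-(1 - a k * C)⁻¹) * hR k + R k * hinv
      rw [hC, e, pow_succ']
      exact (mul_dvd_mul (ha k) (ih (k + 1))).mul_right _
  intro n
  filter_upwards [Filter.eventually_ge_atTop n] with m hm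
  have h := PowerSeries.X_pow_dvd_iff.mp (key m 0) n (by omega)
  rw [map_sub, sub_eq_zero] at h
  exact h

namespace QWeyl

variable {K : Type*} [Field K] (q : K)

/-- The series `∑ t (h+n) h z^n` of the coefficients at level `h`, shifted to start at `1`. -/
noncomputable def towerSeries (h : ℕ) : PowerSeries K :=
  PowerSeries.mk fun n => towerCoeff q (h + n) h

theorem constantCoeff_towerSeries (h : ℕ) :
    PowerSeries.constantCoeff (towerSeries q h) = 1 := by
  rw [← PowerSeries.coeff_zero_eq_constantCoeff_apply, towerSeries, PowerSeries.coeff_mk, add_zero,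
    towerCoeff_self]

theorem towerSeries_zero : towerSeries q 0 =
    1 + PowerSeries.C (qInt q 1) * PowerSeries.X ^ 2 * towerSeries q 1 := by
  ext n
  rw [map_add, mul_assoc, PowerSeries.coeff_C_mul, PowerSeries.coeff_X_pow_mul', towerSeries,
    towerSeries, PowerSeries.coeff_mk, PowerSeries.coeff_mk, PowerSeries.coeff_one, zero_add]
  match n with
  | 0 => simp [towerCoeff_zero]
  | 1 => simp [towerCoeff_succ_zero, towerCoeff_zero]
  | n + 2 => simp [towerCoeff_succ_zero _ (n + 1), add_comm]

theorem towerSeries_succ (h : ℕ) : towerSeries q (h + 1) = towerSeries q h +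
    PowerSeries.C (qInt q (h + 2)) * PowerSeries.X ^ 2 * towerSeries q (h + 2) := by
  ext n
  rw [map_add, mul_assoc, PowerSeries.coeff_C_mul, PowerSeries.coeff_X_pow_mul', towerSeries,
    towerSeries, towerSeries, PowerSeries.coeff_mk, PowerSeries.coeff_mk, PowerSeries.coeff_mk,
    add_right_comm, towerCoeff_succ_succ]
  split_ifs with hn
  · rw [show h + 2 + (n - 2) = h + n by omega]
  · rw [towerCoeff_eq_zero_of_lt q (show h + n < h + 2 by omega)]

theorem eqContinuedFraction_constI :
    EqContinuedFraction (PowerSeries.mk fun n => constI q n)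
      (fun i => PowerSeries.C (qInt q (i + 1)) * PowerSeries.X ^ 2) := by
  have hinv : ∀ h, towerSeries q h * (towerSeries q h)⁻¹ = 1 := fun h =>
    PowerSeries.mul_inv_cancel _ (by simp [constantCoeff_towerSeries])
  have h0 : (PowerSeries.mk fun n => constI q n) = towerSeries q 0 := by
    ext n
    simp [towerSeries, constI_eq_towerCoeff]
  rw [h0]
  refine eqContinuedFraction_of_tails _
    (fun k => Nat.casesOn k (towerSeries q 0)
      fun h => towerSeries q (h + 1) * (towerSeries q h)⁻¹) (fun k => ?_) (fun k => ?_)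
  · exact (dvd_pow_self _ two_ne_zero).mul_left _
  · rcases k with _ | h
    · change (1 - PowerSeries.C (qInt q 1) * PowerSeries.X ^ 2 *
        (towerSeries q 1 * (towerSeries q 0)⁻¹)) * towerSeries q 0 = 1
      linear_combination towerSeries_zero q -
        PowerSeries.C (qInt q 1) * PowerSeries.X ^ 2 * towerSeries q 1 * hinv 0
    · change (1 - PowerSeries.C (qInt q (h + 2)) * PowerSeries.X ^ 2 *
        (towerSeries q (h + 2) * (towerSeries q (h + 1))⁻¹)) *
          (towerSeries q (h + 1) * (towerSeries q h)⁻¹) = 1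
      linear_combination (towerSeries q h)⁻¹ * towerSeries_succ q h + hinv h -
        PowerSeries.C (qInt q (h + 2)) * PowerSeries.X ^ 2 * towerSeries q (h + 2) *
          (towerSeries q h)⁻¹ * hinv (h + 1)

end QWeyl

/-! ### Gaussian binomial coefficients -/

/-- The Gaussian binomial coefficient `binom(h+j, j)_q`, defined by the `q`-Pascal rule, so that it
makes sense also when `q` is a root of unity. -/
def qBinom {K : Type*} [CommRing K] (q : K) : ℕ → ℕ → K
  | 0, _ => 1
  | _ + 1, 0 => 1
  | h + 1, j + 1 => q ^ (j + 1) * qBinom q h (j + 1) + qBinom q (h + 1) j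

section

variable {K : Type*} [CommRing K] (q : K)

theorem qBinom_zero_right (h : ℕ) : qBinom q h 0 = 1 := by
  cases h <;> rw [qBinom]

theorem qBinom_succ_mul (h j : ℕ) :
    (1 - q ^ (h + 1)) * qBinom q (h + 1) j = (1 - q ^ (j + 1)) * qBinom q h (j + 1) := by
  induction h generalizing j with
  | zero =>
    induction j with
    | zero => simp [qBinom]
    | succ j ih =>
      simp only [qBinom] at ih ⊢
      linear_combination ih
  | succ h ihh =>
    induction j with
    | zero =>
      have h1 := ihh 0
      rw [qBinom_zero_right] at h1 ⊢
      rw [qBinom, qBinom_zero_right]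
      linear_combination q * h1
    | succ j ihj =>
      have h1 := ihh (j + 1)
      rw [qBinom, qBinom.eq_3 q h (j + 1)]
      linear_combination q ^ (j + 2) * h1 + ihj

/-- The signed weight `(-1)^j q^(j(j+1)/2) binom(h+j, j)_q`. -/
def qWeight (h j : ℕ) : K := (-1) ^ j * q ^ ((j + 1).choose 2) * qBinom q h j

theorem qWeight_zero_right (h : ℕ) : qWeight q h 0 = 1 := by
  simp [qWeight, qBinom_zero_right]

theorem pow_succ_choose_two (j : ℕ) :
    q ^ ((j + 2).choose 2) = q ^ (j + 1) * q ^ ((j + 1).choose 2) := by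
  rw [← pow_add, Nat.choose_succ_succ' (j + 1) 1, Nat.choose_one_right]

theorem qWeight_zero_succ (j : ℕ) :
    qWeight q 0 (j + 1) + qWeight q 0 j = (1 - q) * qWeight q 1 j := by
  have h := qBinom_succ_mul q 0 j
  simp only [qWeight, pow_succ_choose_two]
  simp only [qBinom, zero_add, pow_one] at h ⊢
  linear_combination (-((-1) ^ j * q ^ ((j + 1).choose 2))) * h

theorem qWeight_succ_succ (h j : ℕ) :
    qWeight q (h + 1) (j + 1) + qWeight q (h + 1) j =
      qWeight q h (j + 1) + (1 - q ^ (h + 2)) * qWeight q (h + 2) j := by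
  have e := qBinom_succ_mul q (h + 1) j
  have e' : qBinom q (h + 1) (j + 1) = q ^ (j + 1) * qBinom q h (j + 1) + qBinom q (h + 1) j := by
    rw [qBinom]
  simp only [qWeight, pow_succ_choose_two]
  linear_combination (-((-1) ^ j * q ^ ((j + 1).choose 2))) * (e + e')

end

/-! ### The Touchard–Riordan formula -/

/-- The ballot number `binom n i - binom n (i-1)`, where `binom n (-1) = 0`. -/
def ballot (K : Type*) [CommRing K] (n : ℕ) : ℕ → K
  | 0 => 1
  | i + 1 => (n.choose (i + 1) : K) - (n.choose i : K)

theorem ballot_succ_succ (K : Type*) [CommRing K] (n i : ℕ) :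
    ballot K (n + 1) (i + 1) = ballot K n (i + 1) + ballot K n i := by
  cases i with
  | zero => simp [ballot]
  | succ i =>
    simp only [ballot, Nat.choose_succ_succ' n, Nat.cast_add]
    ring

theorem ballot_two_mul_add_one (K : Type*) [CommRing K] (m : ℕ) :
    ballot K (2 * m + 1) (m + 1) = 0 := by
  rw [ballot, Nat.choose_symm_half, sub_self]

/-- Pascal's rule for ballot numbers, summed by parts against a sequence of weights. -/
theorem sum_ballot_succ {K : Type*} [CommRing K] (n m : ℕ) (c : ℕ → K) :
    ∑ j ∈ range (m + 2), ballot K (n + 1) (m + 1 - j) * c j =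
      ballot K n (m + 1) * c 0 +
        ∑ j ∈ range (m + 1), ballot K n (m - j) * (c (j + 1) + c j) := by
  have h1 : ∑ j ∈ range (m + 2), ballot K (n + 1) (m + 1 - j) * c j =
      ∑ j ∈ range (m + 2), ballot K n (m + 1 - j) * c j +
        ∑ j ∈ range (m + 1), ballot K n (m - j) * c j := by
    rw [sum_range_succ _ (m + 1), sum_range_succ _ (m + 1), add_right_comm, ← sum_add_distrib]
    congr 1
    · refine sum_congr rfl fun j hj => ?_
      have hj' := mem_range.mp hj
      rw [show m + 1 - j = m - j + 1 by omega, ballot_succ_succ, add_mul]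
    · simp [ballot]
  rw [h1, sum_range_succ']
  simp only [Nat.add_sub_add_right, mul_add, sum_add_distrib, Nat.sub_zero]
  ring

namespace QWeyl

variable {K : Type*} [Field K] (q : K)

theorem one_sub_mul_qInt (n : ℕ) : (1 - q) * qInt q n = 1 - q ^ n := mul_neg_geom_sum q n

/-- The Touchard–Riordan formula at an arbitrary level `h`. The statement for all levels is what
makes the induction on the length `h + 2 m` work. -/
theorem one_sub_pow_mul_towerCoeff (h m : ℕ) : (1 - q) ^ m * towerCoeff q (h + 2 * m) h =
    ∑ j ∈ range (m + 1), ballot K (h + 2 * m) (m - j) * qWeight q h j := by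
  induction hn : h + 2 * m generalizing h m with
  | zero =>
    obtain ⟨rfl, rfl⟩ : h = 0 ∧ m = 0 := by omega
    simp [towerCoeff_zero, ballot, qWeight_zero_right]
  | succ n ih =>
    rcases m with _ | m
    · obtain rfl : n + 1 = h := by omega
      simp [towerCoeff_self, ballot, qWeight_zero_right]
    · rw [sum_ballot_succ]
      rcases h with _ | h
      · obtain rfl : n = 2 * m + 1 := by omega
        have e := ih 1 m (by omega)
        -- the boundary term, which the recurrence at level `0` lacks, is zero by symmetry
        rw [ballot_two_mul_add_one, zero_mul, zero_add, towerCoeff_succ_zero]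
        simp only [qWeight_zero_succ, mul_left_comm _ (1 - q)]
        rw [← mul_sum, ← e]
        simp [qInt]
        ring
      · have e1 := ih h (m + 1) (by omega)
        have e2 := ih (h + 2) m (by omega)
        rw [sum_range_succ'] at e1
        simp only [Nat.add_sub_add_right, Nat.sub_zero, qWeight_zero_right] at e1
        simp only [towerCoeff_succ_succ, qWeight_succ_succ, mul_add, sum_add_distrib,
          mul_left_comm _ (1 - q ^ (h + 2)), qWeight_zero_right]
        rw [← mul_sum, ← e2, ← one_sub_mul_qInt]
        linear_combination e1

/-- Folding the two-sided sum: the terms `-j` and `j + 1` carry the same power of `q` and opposite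
signs, and combine to a ballot number. -/
theorem sum_Icc_eq_sum_ballot (n : ℕ) :
    ∑ k ∈ Icc (-(n : ℤ)) (n : ℤ),
        (-1 : K) ^ k * q ^ (k * (k - 1) / 2) * ((2 * n).choose ((n : ℤ) + k).toNat : K) =
      ∑ j ∈ range (n + 1), ballot K (2 * n) (n - j) * qWeight q 0 j := by
  set f : ℤ → K := fun k =>
    (-1 : K) ^ k * q ^ (k * (k - 1) / 2) * ((2 * n).choose ((n : ℤ) + k).toNat : K) with hf
  have tri : ∀ j : ℕ, (j : ℤ) * (j + 1) / 2 = ((j + 1).choose 2 : ℕ) := by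
    intro j
    rw [Nat.choose_two_right, Nat.add_sub_cancel]
    push_cast
    rw [mul_comm]
  have hneg : ∀ j ∈ range (n + 1), f (-(j : ℤ)) =
      (-1) ^ j * q ^ ((j + 1).choose 2) * ((2 * n).choose (n - j) : K) := by
    intro j hj
    have hj' := mem_range.mp hj
    have e : -(j : ℤ) * (-(j : ℤ) - 1) / 2 = ((j + 1).choose 2 : ℕ) := by
      rw [← tri]; congr 1; ring
    have e' : ((n : ℤ) + -(j : ℤ)).toNat = n - j := by omega
    simp only [hf]
    rw [e, e', zpow_natCast, zpow_neg, zpow_natCast, ← inv_pow, inv_neg_one]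
  have hpos : ∀ j ∈ range n, f ((j : ℤ) + 1) =
      -((-1) ^ j * q ^ ((j + 1).choose 2) * ((2 * n).choose (n - j - 1) : K)) := by
    intro j hj
    have hj' := mem_range.mp hj
    have e : ((j : ℤ) + 1) * ((j : ℤ) + 1 - 1) / 2 = ((j + 1).choose 2 : ℕ) := by
      rw [← tri]; congr 1; ring
    have e' : ((n : ℤ) + ((j : ℤ) + 1)).toNat = n + j + 1 := by omega
    have e'' : (2 * n).choose (n + j + 1) = (2 * n).choose (n - j - 1) :=
      Nat.choose_symm_of_eq_add (by omega)
    simp only [hf]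
    rw [e, e', e'', zpow_natCast, ← Nat.cast_succ, zpow_natCast, pow_succ]
    ring
  have split : ∀ N : ℕ, ∑ k ∈ Icc (-(N : ℤ)) (N : ℤ), f k =
      ∑ j ∈ range (N + 1), f (-(j : ℤ)) + ∑ j ∈ range N, f ((j : ℤ) + 1) := by
    intro N
    induction N with
    | zero => simp
    | succ N ih =>
      have e : Icc (-((N + 1 : ℕ) : ℤ)) ((N + 1 : ℕ) : ℤ) =
          insert (-((N + 1 : ℕ) : ℤ)) (insert ((N : ℤ) + 1) (Icc (-(N : ℤ)) (N : ℤ))) := by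
        ext k
        simp only [mem_Icc, mem_insert]
        omega
      rw [e, sum_insert (by simp only [mem_insert, mem_Icc]; omega),
        sum_insert (by simp only [mem_Icc]; omega), ih, sum_range_succ _ (N + 1),
        sum_range_succ (fun j : ℕ => f ((j : ℤ) + 1)) N]
      ring
  rw [split n, sum_congr rfl hneg, sum_congr rfl hpos, sum_range_succ, sum_range_succ _ n,
    add_right_comm, ← sum_add_distrib]
  congr 1
  · refine sum_congr rfl fun j hj => ?_
    obtain ⟨i, hi⟩ : ∃ i, n - j = i + 1 := ⟨n - j - 1, by have := mem_range.mp hj; omega⟩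
    simp only [hi, ballot, qWeight, qBinom, Nat.add_sub_cancel]
    ring
  · simp [ballot, qWeight, qBinom]

end QWeyl

theorem mainTheorem9 {K : Type*} [Field K] (q : K) :
    EqContinuedFraction (PowerSeries.mk fun n => QWeyl.constI q n)
      (fun i => PowerSeries.C (qInt q (i + 1)) * PowerSeries.X ^ 2) ∧
    (q ≠ 1 → ∀ n : ℕ, QWeyl.constI q (2 * n) =
      1 / (1 - q) ^ n *
        ∑ k ∈ Finset.Icc (-(n : ℤ)) (n : ℤ),
          (-1 : K) ^ k * q ^ (k * (k - 1) / 2) * ((2 * n).choose ((n : ℤ) + k).toNat : K)) ∧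
    (∀ n : ℕ, QWeyl.constI q (2 * n + 1) = 0) := by
  refine ⟨QWeyl.eqContinuedFraction_constI q, fun hq n => ?_, fun n => ?_⟩
  · have h := QWeyl.one_sub_pow_mul_towerCoeff q 0 n
    rw [zero_add] at h
    have hq' : (1 - q) ^ n ≠ 0 := pow_ne_zero _ (sub_ne_zero.mpr hq.symm)
    rw [QWeyl.sum_Icc_eq_sum_ballot, ← h, QWeyl.constI_eq_towerCoeff, ← mul_assoc,
      one_div_mul_cancel hq', one_mul]
  · rw [QWeyl.constI_eq_towerCoeff]
    exact QWeyl.towerCoeff_eq_zero_of_odd q ⟨n, by ring⟩
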